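/- Let $n\in\mathbb N$, let $\{S_m\}_{m\in\mathcal M}$ be a collection of linear subspaces of $\mathbb R^n$, and put $D_m=\dim S_m$, $N_m=n-D_m$. Let $\mathcal L=\{L_m\}_{m\in\mathcal M}$ be a collection of nonnegative numbers and let $K>1$. For $D,N>0$ and $x\ge 0$ define $$\mathrm{Dkhi}[D,N,x]=\frac{1}{\mathbb E(X_D)}\,\mathbb E\Big[\Big(X_D-x\,\frac{X_N}{N}\Big)_+\Big],$$ where $X_D,X_N$ are independent $\chi^2$ random variables with $D$ and $N$ degrees of freedom. For $0<q\le 1$ let $\mathrm{EDkhi}[D,N,q]$ be the unique $x\ge 0$ such that $\mathrm{Dkhi}[D,N,x]=q$. For $m\in\mathcal M$ with $N_m\ge 2$ define $$\mathrm{pen}_{K,\mathcal L}(m)=K\,\frac{N_m}{N_m-1}\,\mathrm{EDkhi}\big[D_m+1,\,N_m-1,\,e^{-L_m}\big].$$ Proposition 4. (i) Let $m\in\mathcal M$ be such that $N_m\ge 7$ and $D_m\ge 1$. Set $D=D_m+1$, $N=N_m-1$ and $\Delta=\dfrac{L_m+\log 5+1/N}{1-5/N}$. Then $$\mathrm{pen}_{K,\mathcal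 L}(m)\le \frac{K(N+1)}{N}\left[1+e^{2\Delta/(N+2)}\sqrt{\Big(1+\frac{2D}{N+2}\Big)\frac{2\Delta}{D}}\,\right]^2 D.$$ (ii) Let $m\in\mathcal M$ be such that $D_m=0$ and $N_m\ge 4$, and set $N=N_m-1$. Then $$\mathrm{pen}_{K,\mathcal L}(m)\le \frac{3K(N+1)}{N}\left[1+e^{2L_m/N}\sqrt{\Big(1+\frac{6}{N}\Big)\frac{2L_m}{3}}\,\right]^2.$$ (iii) For every $\kappa<1$ there is a constant $C>0$ depending on $\kappa$ and $K$ only (in particular not on $n$, on the collection of models or on the weights) such that for every $m\in\mathcal M$ with $N_m\ge 2$ and $\max(L_m,D_m)\le\kappa n$, $$\mathrm{pen}_{K,\mathcal L}(m)\le C\max(L_m,D_m).$$ -/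

import Mathlib

open MeasureTheory ProbabilityTheory Filter Topology

/-- The (central) `χ²` distribution with `k > 0` degrees of freedom, that is, the Gamma
distribution with shape `k / 2` and rate `1 / 2`. -/
noncomputable def chiSq (k : ℝ) : Measure ℝ := gammaMeasure (k / 2) (1 / 2)

/-- `Dkhi[D, N, x] = 𝔼[(X_D - x X_N / N)₊] / 𝔼[X_D]`, where `X_D` and `X_N` are independent `χ²`
random variables with `D` and `N` degrees of freedom; independence is expressed by integrating
against the product of the two laws. -/
noncomputable def Dkhi (D N x : ℝ) : ℝ :=
  1 / (∫ u, u ∂(chiSq D)) *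
    ∫ p : ℝ × ℝ, max (p.1 - x * (p.2 / N)) 0 ∂((chiSq D).prod (chiSq N))

/-- `EDkhi[D, N, q]` is the solution `x ∈ [0, ∞)` of `Dkhi[D, N, x] = q`; for `D, N > 0` and
`0 < q ≤ 1` it exists and is unique, see `existsUnique_Dkhi_eq` and `EDkhi_spec`. -/
noncomputable def EDkhi (D N q : ℝ) : ℝ :=
  Classical.epsilon fun x : ℝ => 0 ≤ x ∧ Dkhi D N x = q

theorem chiSq_isProbabilityMeasure {k : ℝ} (hk : 0 < k) : IsProbabilityMeasure (chiSq k) :=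
  isProbabilityMeasure_gammaMeasure (by positivity) (by norm_num)

theorem chiSq_ae_pos (k : ℝ) : ∀ᵐ u ∂(chiSq k), 0 < u := by
  rw [chiSq, gammaMeasure, ae_withDensity_iff (by unfold gammaPDF; fun_prop)]
  have h0 : ∀ᵐ u : ℝ, u ≠ 0 := by simp [ae_iff]
  filter_upwards [h0] with u hu0 hu
  by_contra hneg
  exact hu (gammaPDF_of_neg (lt_of_le_of_ne (not_lt.1 hneg) hu0))

theorem chiSq_integrable {k : ℝ} (hk : 0 < k) : Integrable (fun u : ℝ => u) (chiSq k) := by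
  have hk2 : 0 < k / 2 := by positivity
  rw [chiSq, gammaMeasure, integrable_withDensity_iff (by unfold gammaPDF; fun_prop)
    (ae_of_all _ fun u => by simp [gammaPDF])]
  have h1 : IntegrableOn (fun u : ℝ => u ^ (k / 2) * Real.exp (-(1 / 2) * u)) (Set.Ioi 0) := by
    have := integrableOn_rpow_mul_exp_neg_mul_rpow (s := k / 2) (p := 1) (b := 1 / 2)
      (by linarith) zero_lt_one (by norm_num)
    simpa using this
  have h2 : Integrable ((Set.Ioi (0 : ℝ)).indicator
      (fun u : ℝ => (1 / 2 : ℝ) ^ (k / 2) / Real.Gamma (k / 2) *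
        (u ^ (k / 2) * Real.exp (-(1 / 2) * u)))) :=
    (integrable_indicator_iff measurableSet_Ioi).2 (h1.const_mul _)
  refine h2.congr (ae_of_all _ fun u => ?_)
  simp only [gammaPDF]
  rw [ENNReal.toReal_ofReal (gammaPDFReal_nonneg hk2 (by norm_num) u)]
  unfold gammaPDFReal
  rcases lt_trichotomy u 0 with hu | hu | hu
  · rw [Set.indicator_of_notMem (by simpa using hu.le), if_neg (by simpa using hu)]
    simp
  · subst hu
    simp
  · rw [Set.indicator_of_mem (by simpa using hu), if_pos hu.le]
    have h3 : u ^ (k / 2) = u * u ^ (k / 2 - 1) := by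
      rw [Real.rpow_sub_one hu.ne']
      field_simp
    rw [h3]
    ring_nf

theorem chiSq_mean_pos {k : ℝ} (hk : 0 < k) : 0 < ∫ u, u ∂(chiSq k) := by
  have := chiSq_isProbabilityMeasure hk
  have hpos := chiSq_ae_pos k
  rw [integral_pos_iff_support_of_nonneg_ae (hpos.mono fun u hu => hu.le) (chiSq_integrable hk)]
  have h1 : chiSq k (Function.support fun u : ℝ => u) = chiSq k Set.univ := by
    refine measure_congr ?_
    filter_upwards [hpos] with u hu
    exact propext ⟨fun _ => trivial, fun _ => hu.ne'⟩
  rw [h1, measure_univ]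
  exact one_pos

/-- For `D, N > 0` and `0 < q ≤ 1`, the equation `Dkhi[D, N, x] = q` has exactly one solution
`x ≥ 0`. -/
theorem existsUnique_Dkhi_eq {D N q : ℝ} (hD : 0 < D) (hN : 0 < N) (hq : 0 < q) (hq1 : q ≤ 1) :
    ∃! x : ℝ, 0 ≤ x ∧ Dkhi D N x = q := by
  have := chiSq_isProbabilityMeasure hD
  have := chiSq_isProbabilityMeasure hN
  set P := (chiSq D).prod (chiSq N) with hP
  set M := ∫ u, u ∂(chiSq D) with hM
  have hMpos : 0 < M := chiSq_mean_pos hD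
  have hint : Integrable (fun p : ℝ × ℝ => p.1) P := (chiSq_integrable hD).comp_fst _
  have hmean : ∫ p, p.1 ∂P = M := by
    rw [hP, integral_fun_fst (fun u : ℝ => u)]
    simp [hM]
  have hp1 : ∀ᵐ p ∂P, 0 < p.1 := Measure.quasiMeasurePreserving_fst.ae (chiSq_ae_pos D)
  have hp2 : ∀ᵐ p ∂P, 0 < p.2 := Measure.quasiMeasurePreserving_snd.ae (chiSq_ae_pos N)
  have hmeas : ∀ x : ℝ, AEStronglyMeasurable
      (fun p : ℝ × ℝ => max (p.1 - x * (p.2 / N)) 0) P := fun x =>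
    (by fun_prop : Continuous fun p : ℝ × ℝ => max (p.1 - x * (p.2 / N)) 0).aestronglyMeasurable
  have hbound : ∀ x : ℝ, 0 ≤ x → ∀ᵐ p ∂P, ‖max (p.1 - x * (p.2 / N)) 0‖ ≤ p.1 := by
    intro x hx
    filter_upwards [hp1, hp2] with p h1 h2
    rw [Real.norm_of_nonneg (le_max_right _ _)]
    have : 0 ≤ x * (p.2 / N) := by positivity
    exact max_le (by linarith) h1.le
  have hI : ∀ x : ℝ, 0 ≤ x → Integrable (fun p : ℝ × ℝ => max (p.1 - x * (p.2 / N)) 0) P :=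
    fun x hx => hint.mono' (hmeas x) (hbound x hx)
  set g : ℝ → ℝ := fun x => ∫ p : ℝ × ℝ, max (p.1 - x * (p.2 / N)) 0 ∂P with hg
  have hDk : ∀ x, Dkhi D N x = 1 / M * g x := fun x => rfl
  have hg0 : g 0 = M := by
    rw [← hmean]
    refine integral_congr_ae ?_
    filter_upwards [hp1] with p h1
    simp [h1.le]
  have hcont : ContinuousOn g (Set.Ici 0) :=
    continuousOn_of_dominated (fun x _ => hmeas x) (fun x hx => hbound x hx) hint
      (ae_of_all _ fun p => by fun_prop)
  have hlim : Tendsto g atTop (𝓝 0) := by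
    have h := tendsto_integral_filter_of_dominated_convergence (μ := P) (l := atTop)
      (F := fun (x : ℝ) (p : ℝ × ℝ) => max (p.1 - x * (p.2 / N)) 0) (f := fun _ => (0 : ℝ))
      (fun p => p.1) (Eventually.of_forall hmeas)
      ((eventually_ge_atTop 0).mono hbound) hint ?_
    · simpa using h
    · filter_upwards [hp2] with p h2
      have h3 : 0 < p.2 / N := by positivity
      refine tendsto_const_nhds.congr' ?_
      filter_upwards [eventually_ge_atTop (p.1 / (p.2 / N))] with x hx
      rw [div_le_iff₀ h3] at hx
      exact (max_eq_right (by linarith)).symm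
  have hqM : 0 < q * M := by positivity
  have hiff : ∀ x, Dkhi D N x = q ↔ g x = q * M := by
    intro x
    rw [hDk, one_div, inv_mul_eq_iff_eq_mul₀ hMpos.ne', mul_comm]
  -- two distinct solutions contradict convexity together with the limit zero at infinity
  have huniq : ∀ x y : ℝ, 0 ≤ x → x < y → g x = q * M → g y = q * M → False := by
    intro x y hx hxy hgx hgy
    obtain ⟨z, hz, hzy⟩ :=
      ((hlim.eventually (gt_mem_nhds hqM)).and (eventually_gt_atTop y)).exists
    have hyz : 0 < z - x := by linarith
    set t := (z - y) / (z - x) with ht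
    have ht0 : 0 ≤ t := div_nonneg (by linarith) hyz.le
    have ht1 : 0 < 1 - t := by
      rw [ht, sub_pos, div_lt_one hyz]
      linarith
    have hyt : y = t * x + (1 - t) * z := by
      rw [ht]
      field_simp
      ring
    have hle : g y ≤ t * g x + (1 - t) * g z := by
      simp only [hg]
      rw [← integral_const_mul, ← integral_const_mul,
        ← integral_add ((hI x hx).const_mul _) ((hI z (by linarith)).const_mul _)]
      refine integral_mono (hI y (by linarith))
        (((hI x hx).const_mul _).add ((hI z (by linarith)).const_mul _)) fun p => ?_
      have h1 := mul_le_mul_of_nonneg_left (le_max_left (p.1 - x * (p.2 / N)) 0) ht0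
      have h2 := mul_le_mul_of_nonneg_left (le_max_left (p.1 - z * (p.2 / N)) 0) ht1.le
      have h3 := mul_nonneg ht0 (le_max_right (p.1 - x * (p.2 / N)) 0)
      have h4 := mul_nonneg ht1.le (le_max_right (p.1 - z * (p.2 / N)) 0)
      refine max_le ?_ (by simpa using add_nonneg h3 h4)
      have h5 : p.1 - y * (p.2 / N) =
          t * (p.1 - x * (p.2 / N)) + (1 - t) * (p.1 - z * (p.2 / N)) := by
        rw [hyt]
        ring
      rw [h5]
      exact add_le_add h1 h2
    have := mul_lt_mul_of_pos_left hz ht1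
    rw [hgx, hgy] at hle
    linarith
  obtain ⟨z, hz, hz0⟩ :=
    ((hlim.eventually (gt_mem_nhds hqM)).and (eventually_ge_atTop (0 : ℝ))).exists
  obtain ⟨x, hx, hgx⟩ := intermediate_value_Icc' hz0 (hcont.mono Set.Icc_subset_Ici_self)
    (show q * M ∈ Set.Icc (g z) (g 0) from ⟨hz.le, by rw [hg0]; nlinarith⟩)
  refine ⟨x, ⟨hx.1, (hiff x).2 hgx⟩, fun y ⟨hy, hgy⟩ => ?_⟩
  rw [hiff] at hgy
  rcases lt_trichotomy y x with h | h | h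
  · exact (huniq y x hy h hgy hgx).elim
  · exact h
  · exact (huniq x y hx.1 h hgx hgy).elim

theorem EDkhi_spec {D N q : ℝ} (hD : 0 < D) (hN : 0 < N) (hq : 0 < q) (hq1 : q ≤ 1) :
    0 ≤ EDkhi D N q ∧ Dkhi D N (EDkhi D N q) = q :=
  Classical.epsilon_spec (p := fun x : ℝ => 0 ≤ x ∧ Dkhi D N x = q)
    (existsUnique_Dkhi_eq hD hN hq hq1).exists

/-- The dimension `D_m` of the model `S_m`, a linear subspace of Euclidean `ℝⁿ`. -/
noncomputable def modelDim {n : ℕ} {ι : Type*}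
    (S : ι → Submodule ℝ (EuclideanSpace ℝ (Fin n))) (m : ι) : ℕ :=
  Module.finrank ℝ (S m)

/-- The codimension `N_m = n - D_m` (no truncation takes place, as `D_m ≤ n`). -/
noncomputable def modelCodim {n : ℕ} {ι : Type*}
    (S : ι → Submodule ℝ (EuclideanSpace ℝ (Fin n))) (m : ι) : ℕ :=
  n - modelDim S m

/-- The penalty
`pen_{K,L}(m) = K * N_m / (N_m - 1) * EDkhi[D_m + 1, N_m - 1, exp (-L_m)]`. -/
noncomputable def penKL {n : ℕ} {ι : Type*} (K : ℝ)
    (S : ι → Submodule ℝ (EuclideanSpace ℝ (Fin n))) (L : ι → ℝ) (m : ι) : ℝ :=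
  K * ((modelCodim S m : ℝ) / ((modelCodim S m : ℝ) - 1)) *
    EDkhi ((modelDim S m : ℝ) + 1) ((modelCodim S m : ℝ) - 1) (Real.exp (-L m))

/-! Since `Dkhi` decreases in `x`, any `x` with `Dkhi D N x ≤ exp (-L)` bounds `EDkhi` from above
(`EDkhi_le`). Such an `x` comes from a Chernoff bound on the excess z = u - x v / N, in one of two
forms.

Bounding z₊ by u exp(s z) size-biases X_D into a χ² variable with D + 2 degrees of freedom and
leaves no prefactor. Bounding it by exp(s z) / (e s) keeps D degrees of freedom at the price of a
prefactor. At the optimal s both become exp(-`fisherRate`), with parameters (D + 2, N) and (D, N +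
2).

The rate is inverted by `le_fisherRate`, which yields the explicit squares of (i) and (ii). In (i)
the prefactor is itself at most the exponential of a small multiple of the rate, which explains the
division by 1 - 5/N. For (iii) the first form suffices when max(L, d) ≥ 1. Otherwise d = 0, and
convexity of `Dkhi` makes `EDkhi` of order L. -/

/-! ### Exponential moments of the χ² law -/

theorem chiSq_integral_rpow_mul_exp {k s p : ℝ} (hk : 0 < k) (hs : s < 1 / 2) (hp : 0 ≤ p) :
    ∫ u, u ^ p * Real.exp (s * u) ∂(chiSq k) =
      (1 / 2 : ℝ) ^ (k / 2) / Real.Gamma (k / 2) *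
        ((1 / (1 / 2 - s)) ^ (k / 2 + p) * Real.Gamma (k / 2 + p)) := by
  have hk2 : 0 < k / 2 := by positivity
  rw [chiSq, gammaMeasure, integral_withDensity_eq_integral_toReal_smul
    (by unfold gammaPDF; fun_prop) (ae_of_all _ fun u => by simp [gammaPDF]),
    ← Real.integral_rpow_mul_exp_neg_mul_Ioi (by linarith) (by linarith : 0 < 1 / 2 - s),
    ← integral_const_mul, ← integral_indicator measurableSet_Ioi]
  have h0 : ∀ᵐ u : ℝ, u ≠ 0 := by simp [ae_iff]
  refine integral_congr_ae ?_
  filter_upwards [h0] with u hu0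
  rw [gammaPDF, ENNReal.toReal_ofReal (gammaPDFReal_nonneg hk2 (by norm_num) u), gammaPDFReal,
    smul_eq_mul]
  rcases lt_or_gt_of_ne hu0 with hu | hu
  · rw [Set.indicator_of_notMem (by simpa using hu.le), if_neg (by simpa using hu), zero_mul]
  · rw [Set.indicator_of_mem (by simpa using hu), if_pos hu.le,
      show k / 2 + p - 1 = (k / 2 - 1) + p by ring, Real.rpow_add hu,
      show -((1 / 2 - s) * u) = -(1 / 2 * u) + s * u by ring, Real.exp_add]
    ring

theorem chiSq_integral_exp {k s : ℝ} (hk : 0 < k) (hs : s < 1 / 2) :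
    ∫ u, Real.exp (s * u) ∂(chiSq k) = (1 - 2 * s) ^ (-(k / 2)) := by
  have h := chiSq_integral_rpow_mul_exp hk hs le_rfl
  have hG := (Real.Gamma_pos_of_pos (half_pos hk)).ne'
  have hs2 : 0 < 1 - 2 * s := by linarith
  simp only [Real.rpow_zero, one_mul, add_zero] at h
  rw [h, show 1 / (1 / 2 - s) = (1 / 2)⁻¹ * (1 - 2 * s)⁻¹ by field_simp,
    Real.mul_rpow (by norm_num) (by positivity), Real.inv_rpow (by norm_num),
    Real.inv_rpow hs2.le, Real.rpow_neg hs2.le]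
  have : (1 / 2 : ℝ) ^ (k / 2) ≠ 0 := by positivity
  field_simp

/-- Size-biasing: u times the χ² density with k degrees of freedom is k times the one with k + 2. -/
theorem chiSq_integral_id_mul_exp {k s : ℝ} (hk : 0 < k) (hs : s < 1 / 2) :
    ∫ u, u * Real.exp (s * u) ∂(chiSq k) = k * (1 - 2 * s) ^ (-((k + 2) / 2)) := by
  have h := chiSq_integral_rpow_mul_exp hk hs zero_le_one
  have hG := (Real.Gamma_pos_of_pos (half_pos hk)).ne'
  have hs2 : 0 < 1 - 2 * s := by linarith
  simp only [Real.rpow_one] at h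
  rw [h, Real.Gamma_add_one (half_pos hk).ne',
    show 1 / (1 / 2 - s) = (1 / 2)⁻¹ * (1 - 2 * s)⁻¹ by field_simp,
    Real.mul_rpow (by norm_num) (by positivity), Real.inv_rpow (by norm_num),
    Real.inv_rpow hs2.le, show -((k + 2) / 2) = -(k / 2 + 1) by ring, Real.rpow_neg hs2.le,
    Real.rpow_add_one (by norm_num : (1 / 2 : ℝ) ≠ 0)]
  have : (1 / 2 : ℝ) ^ (k / 2) ≠ 0 := by positivity
  field_simp

theorem chiSq_mean {k : ℝ} (hk : 0 < k) : ∫ u, u ∂(chiSq k) = k := by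
  simpa using chiSq_integral_id_mul_exp hk (by norm_num : (0 : ℝ) < 1 / 2)

theorem chiSq_integrable_exp {k s : ℝ} (hk : 0 < k) (hs : s < 1 / 2) :
    Integrable (fun u => Real.exp (s * u)) (chiSq k) := by
  -- A non-integrable function has integral zero by convention, so the nonzero closed form gives
  -- integrability.
  refine Integrable.of_integral_ne_zero ?_
  rw [chiSq_integral_exp hk hs]
  exact (Real.rpow_pos_of_pos (by linarith) _).ne'

theorem chiSq_integrable_id_mul_exp {k s : ℝ} (hk : 0 < k) (hs : s < 1 / 2) :
    Integrable (fun u => u * Real.exp (s * u)) (chiSq k) := by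
  refine Integrable.of_integral_ne_zero ?_
  rw [chiSq_integral_id_mul_exp hk hs]
  exact (mul_pos hk (Real.rpow_pos_of_pos (by linarith) _)).ne'

/-! ### Monotonicity and convexity of `Dkhi` -/

theorem chiSq_prod_ae_pos {D N : ℝ} (hD : 0 < D) (hN : 0 < N) :
    ∀ᵐ p ∂((chiSq D).prod (chiSq N)), 0 < p.1 ∧ 0 < p.2 := by
  have := chiSq_isProbabilityMeasure hD
  have := chiSq_isProbabilityMeasure hN
  filter_upwards [Measure.quasiMeasurePreserving_fst.ae (chiSq_ae_pos D),
    Measure.quasiMeasurePreserving_snd.ae (chiSq_ae_pos N)] with p h1 h2 using ⟨h1, h2⟩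

theorem integrable_excess {D N x : ℝ} (hD : 0 < D) (hN : 0 < N) (hx : 0 ≤ x) :
    Integrable (fun p : ℝ × ℝ => max (p.1 - x * (p.2 / N)) 0)
      ((chiSq D).prod (chiSq N)) := by
  have := chiSq_isProbabilityMeasure hD
  have := chiSq_isProbabilityMeasure hN
  refine Integrable.mono' (g := fun p : ℝ × ℝ => p.1) ((chiSq_integrable hD).comp_fst _)
    (by fun_prop : Continuous fun p : ℝ × ℝ => max (p.1 - x * (p.2 / N)) 0).aestronglyMeasurable
    ?_
  filter_upwards [chiSq_prod_ae_pos hD hN] with p ⟨h1, h2⟩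
  rw [Real.norm_of_nonneg (le_max_right _ _)]
  have : 0 ≤ x * (p.2 / N) := by positivity
  exact max_le (by linarith) h1.le

theorem Dkhi_eq {D : ℝ} (hD : 0 < D) (N x : ℝ) :
    Dkhi D N x =
      1 / D * ∫ p : ℝ × ℝ, max (p.1 - x * (p.2 / N)) 0 ∂((chiSq D).prod (chiSq N)) := by
  rw [Dkhi, chiSq_mean hD]

theorem Dkhi_zero {D N : ℝ} (hD : 0 < D) (hN : 0 < N) : Dkhi D N 0 = 1 := by
  have := chiSq_isProbabilityMeasure hD
  have := chiSq_isProbabilityMeasure hN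
  have h : ∫ p : ℝ × ℝ, max (p.1 - 0 * (p.2 / N)) 0 ∂((chiSq D).prod (chiSq N)) = D := by
    have h1 := integral_fun_fst (μ := chiSq D) (ν := chiSq N) (fun u : ℝ => u)
    rw [chiSq_mean hD, probReal_univ, one_smul] at h1
    refine (integral_congr_ae ?_).trans h1
    filter_upwards [chiSq_prod_ae_pos hD hN] with p hp
    simp [hp.1.le]
  rw [Dkhi_eq hD, h]
  field_simp

theorem Dkhi_antitone {D N x y : ℝ} (hD : 0 < D) (hN : 0 < N) (hx : 0 ≤ x) (hxy : x ≤ y) :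
    Dkhi D N y ≤ Dkhi D N x := by
  rw [Dkhi_eq hD, Dkhi_eq hD]
  refine mul_le_mul_of_nonneg_left (integral_mono_ae (integrable_excess hD hN (hx.trans hxy))
    (integrable_excess hD hN hx) ?_) (by positivity)
  filter_upwards [chiSq_prod_ae_pos hD hN] with p ⟨_, h2⟩
  have : x * (p.2 / N) ≤ y * (p.2 / N) := by gcongr
  exact max_le_max (by linarith) le_rfl

/-- Convexity of `Dkhi D N` along the segment from the origin, where its value is `1`. -/
theorem Dkhi_mul_le {D N x t : ℝ} (hD : 0 < D) (hN : 0 < N) (hx : 0 ≤ x) (ht : 0 ≤ t)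
    (ht1 : t ≤ 1) : Dkhi D N (t * x) ≤ 1 - t + t * Dkhi D N x := by
  have h0 := Dkhi_zero hD hN
  suffices h : Dkhi D N (t * x) ≤ (1 - t) * Dkhi D N 0 + t * Dkhi D N x by
    rwa [h0, mul_one] at h
  simp only [Dkhi_eq hD]
  have hi0 := (integrable_excess hD hN le_rfl).const_mul (1 - t)
  have hi1 := (integrable_excess hD hN hx).const_mul t
  rw [mul_left_comm (1 - t), mul_left_comm t, ← mul_add,
    ← integral_const_mul (1 - t), ← integral_const_mul t, ← integral_add hi0 hi1]
  refine mul_le_mul_of_nonneg_left (integral_mono (integrable_excess hD hN (by positivity))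
    (hi0.add hi1) fun p => ?_) (by positivity)
  have h1 := mul_le_mul_of_nonneg_left (le_max_left (p.1 - 0 * (p.2 / N)) 0) (sub_nonneg.2 ht1)
  have h2 := mul_le_mul_of_nonneg_left (le_max_left (p.1 - x * (p.2 / N)) 0) ht
  have h3 := mul_nonneg (sub_nonneg.2 ht1) (le_max_right (p.1 - 0 * (p.2 / N)) 0)
  have h4 := mul_nonneg ht (le_max_right (p.1 - x * (p.2 / N)) 0)
  exact max_le (by linarith) (by simpa using add_nonneg h3 h4)

/-- Weak monotonicity is enough: if x lay below the root, `Dkhi` would equal q at x as well, against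
uniqueness. -/
theorem EDkhi_le {D N q x : ℝ} (hD : 0 < D) (hN : 0 < N) (hq : 0 < q) (hq1 : q ≤ 1)
    (hx : 0 ≤ x) (h : Dkhi D N x ≤ q) : EDkhi D N q ≤ x := by
  obtain ⟨he, hE⟩ := EDkhi_spec hD hN hq hq1
  by_contra! hlt
  have h1 := Dkhi_antitone hD hN hx hlt.le
  exact hlt.ne ((existsUnique_Dkhi_eq hD hN hq hq1).unique ⟨hx, le_antisymm h (hE ▸ h1)⟩ ⟨he, hE⟩)

/-! ### Chernoff bounds for `Dkhi` -/

/-- The majorant is a product of a function of u and one of v, so by independence its mean factors;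
the v-part is a Laplace transform at -s x / N. -/
theorem Dkhi_le_of_excess_le {D N x s c j : ℝ} {F : ℝ → ℝ} (hD : 0 < D) (hN : 0 < N)
    (hx : 0 ≤ x) (hs : 0 ≤ s) (hF : Integrable (fun u => F u * Real.exp (s * u)) (chiSq D))
    (hFi : ∫ u, F u * Real.exp (s * u) ∂(chiSq D) = j)
    (hle : ∀ u v : ℝ, 0 < u → 0 < v →
      max (u - x * (v / N)) 0 ≤ c * (F u * Real.exp (s * (u - x * (v / N))))) :
    Dkhi D N x ≤ 1 / D * (c * (j * (1 + 2 * s * x / N) ^ (-(N / 2)))) := by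
  have := chiSq_isProbabilityMeasure hD
  have := chiSq_isProbabilityMeasure hN
  have hneg : -(s * x / N) < 1 / 2 := by
    have : 0 ≤ s * x / N := by positivity
    linarith
  have hfac : ∀ p : ℝ × ℝ, c * (F p.1 * Real.exp (s * (p.1 - x * (p.2 / N)))) =
      c * (F p.1 * Real.exp (s * p.1) * Real.exp (-(s * x / N) * p.2)) := fun p => by
    rw [mul_assoc (F p.1), ← Real.exp_add]
    congr 3
    ring
  have hint := (hF.mul_prod (chiSq_integrable_exp hN hneg)).const_mul c
  have hval : ∫ p : ℝ × ℝ, c * (F p.1 * Real.exp (s * p.1) * Real.exp (-(s * x / N) * p.2))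
      ∂((chiSq D).prod (chiSq N)) = c * (j * (1 + 2 * s * x / N) ^ (-(N / 2))) := by
    rw [integral_const_mul, integral_prod_mul (fun u => F u * Real.exp (s * u))
      (fun v => Real.exp (-(s * x / N) * v)), hFi, chiSq_integral_exp hN hneg]
    congr 4
    ring
  rw [Dkhi_eq hD, ← hval]
  refine mul_le_mul_of_nonneg_left (integral_mono_ae (integrable_excess hD hN hx) hint ?_)
    (by positivity)
  filter_upwards [chiSq_prod_ae_pos hD hN] with p ⟨h1, h2⟩
  exact (hle p.1 p.2 h1 h2).trans_eq (hfac p)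

theorem Dkhi_le_rpow {D N x s : ℝ} (hD : 0 < D) (hN : 0 < N) (hx : 0 ≤ x) (hs : 0 ≤ s)
    (hs' : s < 1 / 2) :
    Dkhi D N x ≤ (1 - 2 * s) ^ (-((D + 2) / 2)) * (1 + 2 * s * x / N) ^ (-(N / 2)) := by
  refine (Dkhi_le_of_excess_le (c := 1) hD hN hx hs (chiSq_integrable_id_mul_exp hD hs')
    (chiSq_integral_id_mul_exp hD hs') fun u v hu hv => ?_).trans_eq (by field_simp)
  rw [one_mul]
  refine max_le ?_ (by positivity)
  have hxv : 0 ≤ x * (v / N) := by positivity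
  rcases le_or_gt (u - x * (v / N)) 0 with h | h
  · exact h.trans (by positivity)
  · calc u - x * (v / N) ≤ u * 1 := by linarith
      _ ≤ _ := mul_le_mul_of_nonneg_left (Real.one_le_exp (by positivity)) hu.le

theorem Dkhi_le_rpow' {D N x s : ℝ} (hD : 0 < D) (hN : 0 < N) (hx : 0 ≤ x) (hs : 0 < s)
    (hs' : s < 1 / 2) :
    Dkhi D N x ≤ 1 / (D * (Real.exp 1 * s)) *
      ((1 - 2 * s) ^ (-(D / 2)) * (1 + 2 * s * x / N) ^ (-(N / 2))) := by
  refine (Dkhi_le_of_excess_le (c := 1 / (Real.exp 1 * s)) (F := fun _ => 1) hD hN hx hs.le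
    (by simpa using chiSq_integrable_exp hD hs')
    (by simpa using chiSq_integral_exp hD hs') fun u v hu hv => ?_).trans_eq
      (by field_simp)
  refine max_le ?_ (by positivity)
  -- t ≤ exp(t - 1) at t = s z, the sharp linear bound, tangent at t = 1.
  have h := Real.add_one_le_exp (s * (u - x * (v / N)) - 1)
  rw [Real.exp_sub, sub_add_cancel, le_div_iff₀ (Real.exp_pos 1)] at h
  rw [one_mul, one_div_mul_eq_div, le_div_iff₀ (by positivity)]
  linarith

/-! ### The Fisher rate and its inversion -/

/-- The Chernoff rate at the point `f` of the Fisher distribution with `D` and `N` degrees of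
freedom. -/
noncomputable def fisherRate (D N f : ℝ) : ℝ :=
  (N + D) / 2 * Real.log ((N + D * f) / (N + D)) - D / 2 * Real.log f

/-- Jensen for the logarithm at 1 and y, with weights proportional to p and q. -/
theorem mul_log_le_add_mul_log {p q y : ℝ} (hp : 0 < p) (hq : 0 < q) (hy : 0 < y) :
    q * Real.log y ≤ (p + q) * Real.log ((p + q * y) / (p + q)) := by
  have h := strictConcaveOn_log_Ioi.concaveOn.2 (Set.mem_Ioi.2 one_pos) (Set.mem_Ioi.2 hy)
    (by positivity : 0 ≤ p / (p + q)) (by positivity : 0 ≤ q / (p + q)) (by field_simp)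
  simp only [smul_eq_mul, Real.log_one, mul_zero, zero_add, mul_one] at h
  rw [show p / (p + q) + q / (p + q) * y = (p + q * y) / (p + q) by ring] at h
  calc q * Real.log y = (p + q) * (q / (p + q) * Real.log y) := by field_simp
    _ ≤ _ := by gcongr

theorem fisherRate_nonneg {D N f : ℝ} (hD : 0 < D) (hN : 0 < N) (hf : 0 < f) :
    0 ≤ fisherRate D N f := by
  have := mul_log_le_add_mul_log hN hD hf
  unfold fisherRate
  linarith

/-- After taking logarithms, the gap between the two sides is smallest at f = 2 (`h1`). There the
left side is 1, and the claim is nonnegativity of the rate (`h2`). -/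
theorem div_le_exp_fisherRate {D N f : ℝ} (hD : 0 < D) (hN : 0 < N) (hf : 0 < f) :
    (N + D * f) / (N + 2 * D) ≤ Real.exp (4 * fisherRate D N f / N) := by
  have hND : 0 < N + D := by positivity
  have hND2 : 0 < N + 2 * D := by positivity
  have hw : 0 < N + D * f := by positivity
  rw [← Real.log_le_iff_le_exp (by positivity), le_div_iff₀ hN, fisherRate]
  have h1 := mul_log_le_add_mul_log hN (by positivity : 0 < 2 * D) (half_pos hf)
  have h2 := mul_log_le_add_mul_log hN hD two_pos
  rw [show N + 2 * D * (f / 2) = N + D * f by ring] at h1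
  rw [mul_comm D 2] at h2
  rw [Real.log_div hw.ne' hND2.ne'] at h1 ⊢
  rw [Real.log_div hf.ne' two_ne_zero] at h1
  rw [Real.log_div hND2.ne' hND.ne'] at h2
  rw [Real.log_div hw.ne' hND.ne']
  linarith

theorem hasDerivAt_fisherRate {D N u : ℝ} (hD : 0 < D) (hN : 0 < N) (hu : 0 ≤ u) :
    HasDerivAt (fun u => fisherRate D N ((1 + u) ^ 2))
      (D * N * (u * (2 + u)) / ((1 + u) * (N + D * (1 + u) ^ 2))) u := by
  have hw : 0 < N + D * (1 + u) ^ 2 := by positivity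
  have hsq : HasDerivAt (fun u : ℝ => (1 + u) ^ 2) (2 * (1 + u)) u := by
    simpa using ((hasDerivAt_id u).const_add 1).fun_pow 2
  have h1 := ((((hsq.const_mul D).const_add N).div_const (N + D)).log (by positivity)).const_mul
    ((N + D) / 2)
  have h2 := (hsq.log (by positivity)).const_mul (D / 2)
  refine (h1.sub h2).congr_deriv ?_
  field_simp
  ring

/-- Both sides vanish at u = 0, so derivatives are compared. With h the rate, h' has N + D(1 + u)²
in its denominator; the factor exp(4h/N) cancels it by `div_le_exp_fisherRate`. -/
theorem sq_le_fisherRate_mul_exp {D N u : ℝ} (hD : 0 < D) (hN : 0 < N) (hu : 0 ≤ u) :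
    D * N / (2 * (N + 2 * D)) * u ^ 2 ≤
      fisherRate D N ((1 + u) ^ 2) * Real.exp (4 * fisherRate D N ((1 + u) ^ 2) / N) := by
  set c := D * N / (2 * (N + 2 * D)) with hc
  set h : ℝ → ℝ := fun u => fisherRate D N ((1 + u) ^ 2) with hh
  have hder : ∀ x : ℝ, 0 ≤ x → ∃ h' : ℝ, HasDerivAt h h' x ∧
      HasDerivAt (fun u => h u * Real.exp (4 * h u / N) - c * u ^ 2)
        (h' * Real.exp (4 * h x / N) + h x * (Real.exp (4 * h x / N) * (4 * h' / N)) -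
          c * (2 * x)) x ∧ 0 ≤ h' ∧ 2 * c * x ≤ h' * Real.exp (4 * h x / N) := by
    intro x hx
    have h1 := hasDerivAt_fisherRate hD hN hx
    refine ⟨_, h1, ?_, by positivity, ?_⟩
    · have h2 := (h1.fun_mul ((h1.const_mul 4).div_const N).exp).fun_sub
        (((hasDerivAt_id x).fun_pow 2).const_mul c)
      simpa using h2
    · have h3 := div_le_exp_fisherRate hD hN (by positivity : 0 < (1 + x) ^ 2)
      refine le_trans ?_ (mul_le_mul_of_nonneg_left h3 (by positivity))
      -- The factor left after cancellation, (2 + x)/(1 + x), is at least 1.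
      have h4 : D * N * (x * (2 + x)) / ((1 + x) * (N + D * (1 + x) ^ 2)) *
          ((N + D * (1 + x) ^ 2) / (N + 2 * D)) =
          D * N * x / (N + 2 * D) * ((2 + x) / (1 + x)) := by
        field_simp
      rw [h4, show 2 * c * x = D * N * x / (N + 2 * D) * 1 by rw [hc]; field_simp]
      refine mul_le_mul_of_nonneg_left ?_ (by positivity)
      rw [le_div_iff₀ (by positivity)]
      linarith
  have hmono : MonotoneOn (fun u => h u * Real.exp (4 * h u / N) - c * u ^ 2) (Set.Ici 0) := by
    refine monotoneOn_of_deriv_nonneg (convex_Ici 0) (fun x hx => ?_) (fun x hx => ?_)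
      (fun x hx => ?_)
    · obtain ⟨_, _, hd, _⟩ := hder x hx
      exact hd.continuousAt.continuousWithinAt
    · rw [interior_Ici] at hx
      obtain ⟨_, _, hd, _⟩ := hder x (le_of_lt hx)
      exact hd.differentiableAt.differentiableWithinAt
    · rw [interior_Ici, Set.mem_Ioi] at hx
      obtain ⟨h', _, hd, h0, hle⟩ := hder x hx.le
      have hx0 : 0 ≤ h x := fisherRate_nonneg hD hN (by positivity)
      have : 0 ≤ h x * (Real.exp (4 * h x / N) * (4 * h' / N)) := by positivity
      rw [hd.deriv]
      linarith
  have h0 : h 0 = 0 := by simp [hh, fisherRate, (by positivity : N + D ≠ 0)]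
  have := hmono (Set.mem_Ici.2 le_rfl) (Set.mem_Ici.2 hu) hu
  simp only [h0, zero_mul, ne_eq, OfNat.ofNat_ne_zero, not_false_eq_true, zero_pow, mul_zero,
    sub_self] at this
  linarith

/-- The point u is chosen so that the quadratic lower bound equals x exp(4x/N); since t exp(4t/N)
increases in t ≥ 0, the rate is at least x. -/
theorem le_fisherRate {D N x : ℝ} (hD : 0 < D) (hN : 0 < N) (hx : 0 ≤ x) :
    x ≤ fisherRate D N
      ((1 + Real.exp (2 * x / N) * Real.sqrt ((1 + 2 * D / N) * (2 * x / D))) ^ 2) := by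
  set u := Real.exp (2 * x / N) * Real.sqrt ((1 + 2 * D / N) * (2 * x / D)) with hu
  have hu0 : 0 ≤ u := by positivity
  have h := sq_le_fisherRate_mul_exp hD hN hu0
  have h0 := fisherRate_nonneg hD hN (by positivity : 0 < (1 + u) ^ 2)
  have hsq : D * N / (2 * (N + 2 * D)) * u ^ 2 = x * Real.exp (4 * x / N) := by
    rw [hu, mul_pow, Real.sq_sqrt (by positivity), ← Real.exp_nat_mul,
      show ((2 : ℕ) : ℝ) * (2 * x / N) = 4 * x / N by push_cast; ring]
    field_simp
  rw [hsq] at h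
  by_contra! hlt
  refine h.not_gt (mul_lt_mul'' hlt ?_ h0 (Real.exp_pos _).le)
  rw [Real.exp_lt_exp]
  gcongr

theorem rpow_mul_rpow_eq_exp_neg_fisherRate {D N f : ℝ} (hD : 0 < D) (hN : 0 < N) (hf : 0 < f) :
    ((N + D * f) / (f * (N + D))) ^ (-(D / 2)) * ((N + D * f) / (N + D)) ^ (-(N / 2)) =
      Real.exp (-fisherRate D N f) := by
  have hND : 0 < N + D := by positivity
  have hw : 0 < N + D * f := by positivity
  rw [Real.rpow_def_of_pos (by positivity), Real.rpow_def_of_pos (by positivity), ← Real.exp_add,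
    fisherRate, Real.log_div hw.ne' (by positivity), Real.log_div hw.ne' hND.ne',
    Real.log_mul hf.ne' hND.ne']
  congr 1
  ring

/-- The minimiser `s` of the Chernoff bound of the Fisher distribution. -/
theorem exists_fisher_tilt {D N f : ℝ} (hD : 0 < D) (hN : 0 < N) (hf : 1 ≤ f) :
    ∃ s : ℝ, 0 ≤ s ∧ s < 1 / 2 ∧ s = N * (f - 1) / (2 * (f * (N + D))) ∧
      1 - 2 * s = (N + D * f) / (f * (N + D)) ∧
      1 + 2 * s * (D * f) / N = (N + D * f) / (N + D) := by
  have hf0 : 0 < f := by linarith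
  have h1 : 1 - 2 * (N * (f - 1) / (2 * (f * (N + D)))) = (N + D * f) / (f * (N + D)) := by
    field_simp
    ring
  refine ⟨_, div_nonneg (mul_nonneg hN.le (by linarith)) (by positivity), ?_, rfl, h1, ?_⟩
  · have : 0 < (N + D * f) / (f * (N + D)) := by positivity
    linarith
  · field_simp
    ring

theorem Dkhi_le_exp_neg_fisherRate {D N f : ℝ} (hD : 0 < D) (hN : 0 < N) (hf : 1 ≤ f) :
    Dkhi D N ((D + 2) * f) ≤ Real.exp (-fisherRate (D + 2) N f) := by
  have hf0 : 0 < f := by linarith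
  obtain ⟨s, hs, hs', _, h1, h2⟩ := exists_fisher_tilt (by positivity : 0 < D + 2) hN hf
  rw [← rpow_mul_rpow_eq_exp_neg_fisherRate (by positivity) hN hf0, ← h1, ← h2]
  exact Dkhi_le_rpow hD hN (by positivity) hs hs'

theorem Dkhi_le_mul_exp_neg_fisherRate {D N f : ℝ} (hD : 0 < D) (hN : 0 < N) (hf : 1 < f) :
    Dkhi D N (D * f) ≤ 2 * f * (N + 2 + D * f) / (Real.exp 1 * D * (f - 1) * (N + 2)) *
      Real.exp (-fisherRate D (N + 2) f) := by
  have hf0 : 0 < f := by linarith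
  have hf1 : 0 < f - 1 := by linarith
  have hN2 : 0 < N + 2 := by positivity
  obtain ⟨s, hs, hs', hse, h1, h2⟩ := exists_fisher_tilt hD hN2 hf.le
  have hs0 : 0 < s := by rw [hse]; positivity
  refine (Dkhi_le_rpow' hD hN (by positivity) hs0 hs').trans ?_
  set w := (N + 2 + D * f) / (N + 2 + D) with hw
  have hw0 : 0 < w := by positivity
  -- Raising N to N + 2 in the exponent costs one factor w; raising it in the base only lowers the
  -- base, whose exponent is negative.
  have h3 : (1 + 2 * s * (D * f) / N) ^ (-(N / 2)) ≤ w * w ^ (-((N + 2) / 2)) := by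
    rw [show -((N + 2) / 2) = -(N / 2) - 1 by ring, Real.rpow_sub_one hw0.ne',
      mul_div_cancel₀ _ hw0.ne', ← h2]
    refine Real.rpow_le_rpow_of_nonpos (by positivity) ?_ (by linarith)
    gcongr
    linarith
  rw [← rpow_mul_rpow_eq_exp_neg_fisherRate hD hN2 hf0, ← h1, ← hw]
  calc _ ≤ 1 / (D * (Real.exp 1 * s)) * ((1 - 2 * s) ^ (-(D / 2)) *
        (w * w ^ (-((N + 2) / 2)))) := by
        have : 0 ≤ (1 - 2 * s) ^ (-(D / 2)) := Real.rpow_nonneg (by linarith) _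
        gcongr
    _ = w / (D * (Real.exp 1 * s)) * ((1 - 2 * s) ^ (-(D / 2)) * w ^ (-((N + 2) / 2))) := by ring
    _ = _ := by
        congr 1
        rw [hw, hse]
        field_simp

/-! ### Explicit bounds for `EDkhi` -/

theorem EDkhi_exp_neg_le {D N L : ℝ} (hD : 0 < D) (hN : 0 < N) (hL : 0 ≤ L) :
    EDkhi D N (Real.exp (-L)) ≤ (D + 2) *
      (1 + Real.exp (2 * L / N) *
        Real.sqrt ((1 + 2 * (D + 2) / N) * (2 * L / (D + 2)))) ^ 2 := by
  refine EDkhi_le hD hN (Real.exp_pos _) (Real.exp_le_one_iff.2 (by linarith)) (by positivity) ?_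
  refine (Dkhi_le_exp_neg_fisherRate hD hN ?_).trans
    (Real.exp_le_exp.2 (neg_le_neg (le_fisherRate (by positivity) hN hL)))
  exact one_le_pow₀ (le_add_of_nonneg_right (by positivity))

theorem EDkhi_exp_neg_le_of_two_le {D N L Δ : ℝ} (hD : 2 ≤ D) (hN : 6 ≤ N) (hL : 0 ≤ L)
    (hΔ : Δ = (L + Real.log 5 + 1 / N) / (1 - 5 / N)) :
    EDkhi D N (Real.exp (-L)) ≤
      (1 + Real.exp (2 * Δ / (N + 2)) *
        Real.sqrt ((1 + 2 * D / (N + 2)) * (2 * Δ / D))) ^ 2 * D := by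
  have hN0 : 0 < N := by linarith
  have hD0 : 0 < D := by linarith
  have h5N : 0 < 1 - 5 / N := by
    rw [sub_pos, div_lt_one hN0]
    linarith
  have h5N' : 1 - 5 / N ≤ 1 := by
    have : 0 ≤ 5 / N := by positivity
    linarith
  have hN1 : 0 < 1 / N := by positivity
  have hlog : 1 ≤ Real.log 5 := by
    rw [Real.le_log_iff_exp_le (by norm_num)]
    linarith [Real.exp_one_lt_d9]
  have hΔmul : (1 - 5 / N) * Δ = L + Real.log 5 + 1 / N := by
    rw [hΔ, mul_div_cancel₀ _ h5N.ne']
  have hΔ1 : 1 ≤ Δ := by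
    rw [hΔ, le_div_iff₀ h5N]
    linarith
  have hΔ0 : 0 ≤ Δ := by linarith
  set q := 1 + 2 * D / (N + 2) with hq
  set u := Real.exp (2 * Δ / (N + 2)) * Real.sqrt (q * (2 * Δ / D)) with hu
  set f := (1 + u) ^ 2 with hf
  have hq0 : 0 < q := by positivity
  have hu0 : 0 < u := by positivity
  -- From N + 2 ≥ 8 and D ≥ 2: 2q ≤ 2 + D/2 ≤ 3D/2.
  have hqD : 2 * q ≤ 3 / 2 * D := by
    have : 2 * D / (N + 2) ≤ 2 * D / 8 := by gcongr; linarith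
    linarith
  -- Already D u² ≥ 2 q Δ, and Δ ≥ 1; this is where log 5 in Δ is used.
  have hDf : 2 * q ≤ D * (f - 1) := by
    have h1 : u ^ 2 * D = Real.exp (2 * Δ / (N + 2)) ^ 2 * (2 * q * Δ) := by
      rw [hu, mul_pow, Real.sq_sqrt (by positivity)]
      field_simp
    have h2 : 1 ≤ Real.exp (2 * Δ / (N + 2)) ^ 2 :=
      one_le_pow₀ (Real.one_le_exp (by positivity))
    have h3 : 1 * (2 * q * 1) ≤ Real.exp (2 * Δ / (N + 2)) ^ 2 * (2 * q * Δ) := by gcongr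
    have h4 : 0 ≤ u * D := by positivity
    rw [hf]
    linarith
  have hf1 : 1 < f := one_lt_pow₀ (by linarith) two_ne_zero
  have hf0 : 0 < f := by linarith
  have hf1' : 0 < f - 1 := by linarith
  have hrate : Δ ≤ fisherRate D (N + 2) f := le_fisherRate hD0 (by linarith) hΔ0
  set R := fisherRate D (N + 2) f with hR
  refine EDkhi_le hD0 hN0 (Real.exp_pos _) (Real.exp_le_one_iff.2 (by linarith)) (by positivity) ?_
  rw [mul_comm f D]
  refine (Dkhi_le_mul_exp_neg_fisherRate hD0 hN0 hf1).trans ?_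
  have hpre : 2 * f * (N + 2 + D * f) / (Real.exp 1 * D * (f - 1) * (N + 2)) ≤
      Real.exp (4 * R / (N + 2)) := by
    have h1 := div_le_exp_fisherRate hD0 (by linarith : 0 < N + 2) hf0
    refine le_trans ?_ h1
    rw [div_le_div_iff₀ (by positivity) (by positivity)]
    have h2 : N + 2 + 2 * D = q * (N + 2) := by
      rw [hq]
      field_simp
    -- Split f = (f - 1) + 1: the two bounds on 2q add up to (5/2) D (f - 1), and 5/2 ≤ e.
    have h3 : 2 * f * q ≤ Real.exp 1 * (D * (f - 1)) := by
      have he : 5 / 2 ≤ Real.exp 1 := by linarith [Real.exp_one_gt_d9]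
      have h4 := mul_le_mul_of_nonneg_right hqD hf1'.le
      have h5 : 0 ≤ D * (f - 1) := by positivity
      have h6 := mul_le_mul_of_nonneg_right he h5
      linarith
    calc _ = (2 * f * q) * ((N + 2 + D * f) * (N + 2)) := by rw [h2]; ring
      _ ≤ (Real.exp 1 * (D * (f - 1))) * ((N + 2 + D * f) * (N + 2)) := by gcongr
      _ = _ := by ring
  have hR0 : 0 ≤ R := hΔ0.trans hrate
  calc _ ≤ Real.exp (4 * R / (N + 2)) * Real.exp (-R) := by gcongr
    _ = Real.exp (4 * R / (N + 2) - R) := by rw [← Real.exp_add]; ring_nf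
    -- The remaining exponent R - 4R/(N + 2) is at least (1 - 5/N) Δ = L + log 5 + 1/N.
    _ ≤ Real.exp (-L) := by
      have h1 : 4 * R / (N + 2) ≤ 5 * R / N := by gcongr <;> linarith
      have h2 := mul_le_mul_of_nonneg_left hrate h5N.le
      have h3 : (1 - 5 / N) * R = R - 5 * R / N := by ring
      rw [Real.exp_le_exp]
      linarith

/-- The convex function `Dkhi` lies below its chord from the origin to the root at level 1/e. The
chord reaches exp(-L) at the fraction t of that root, and t ≤ 2L because 1 - exp(-L) ≤ L and 1 - 1/e
≥ 1/2. -/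
theorem EDkhi_exp_neg_le_mul {D N L : ℝ} (hD : 0 < D) (hN : 0 < N) (hL : 0 ≤ L) (hL1 : L ≤ 1) :
    EDkhi D N (Real.exp (-L)) ≤ 2 * L * EDkhi D N (Real.exp (-1)) := by
  obtain ⟨hx, hE⟩ := EDkhi_spec hD hN (Real.exp_pos (-1)) (Real.exp_le_one_iff.2 (by norm_num))
  have he : Real.exp (-1) ≤ 1 / 2 := by
    rw [Real.exp_neg, inv_le_comm₀ (Real.exp_pos 1) (by norm_num)]
    linarith [Real.add_one_le_exp 1]
  have he1 : 0 < 1 - Real.exp (-1) := by linarith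
  have hLe : Real.exp (-L) ≤ 1 := Real.exp_le_one_iff.2 (by linarith)
  set t := (1 - Real.exp (-L)) / (1 - Real.exp (-1)) with ht
  have ht0 : 0 ≤ t := div_nonneg (by linarith) he1.le
  have ht1 : t ≤ 1 := by
    rw [ht, div_le_one he1]
    linarith [Real.exp_le_exp.2 (neg_le_neg hL1)]
  have htL : t ≤ 2 * L := by
    rw [ht, div_le_iff₀ he1]
    nlinarith [Real.add_one_le_exp (-L)]
  have htmul : t * (1 - Real.exp (-1)) = 1 - Real.exp (-L) := div_mul_cancel₀ _ he1.ne'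
  have h := Dkhi_mul_le hD hN hx ht0 ht1
  rw [hE] at h
  refine (EDkhi_le (x := t * EDkhi D N (Real.exp (-1))) hD hN (Real.exp_pos _) hLe
    (by positivity) (by linarith)).trans ?_
  gcongr

theorem EDkhi_exp_neg_le_mul_max {N L r : ℝ} {d : ℕ} (hN : 1 ≤ N) (hL : 0 ≤ L) (hr : 0 ≤ r)
    (hLr : L ≤ r * N) (hdr : d ≤ r * N) (hM : 1 ≤ max L d) :
    EDkhi (d + 1) N (Real.exp (-L)) ≤
      (8 + 4 * Real.exp (4 * r) * (7 + 2 * r)) * max L d := by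
  have hN0 : 0 < N := by linarith
  set y := Real.exp (2 * L / N) *
    Real.sqrt ((1 + 2 * ((d : ℝ) + 1 + 2) / N) * (2 * L / (d + 1 + 2))) with hy
  have hy2 : ((d : ℝ) + 1 + 2) * y ^ 2 =
      4 / 2 * Real.exp (4 * L / N) * (1 + 2 * ((d : ℝ) + 1 + 2) / N) * L := by
    rw [hy, mul_pow, Real.sq_sqrt (by positivity), ← Real.exp_nat_mul,
      show ((2 : ℕ) : ℝ) * (2 * L / N) = 4 * L / N by push_cast; ring]
    field_simp
    ring
  have hexp : Real.exp (4 * L / N) ≤ Real.exp (4 * r) := by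
    rw [Real.exp_le_exp, div_le_iff₀ hN0]
    linarith
  have hfac : 1 + 2 * ((d : ℝ) + 1 + 2) / N ≤ 7 + 2 * r := by
    have : 2 * ((d : ℝ) + 1 + 2) / N ≤ 6 + 2 * r := by
      rw [div_le_iff₀ hN0]
      nlinarith
    linarith
  have hd : 2 * ((d : ℝ) + 1 + 2) ≤ 8 * max L d := by linarith [le_max_right L (d : ℝ)]
  have hsq : (1 + y) ^ 2 ≤ 2 + 2 * y ^ 2 := by linarith [sq_nonneg (1 - y)]
  calc _ ≤ ((d : ℝ) + 1 + 2) * (1 + y) ^ 2 := EDkhi_exp_neg_le (by positivity) hN0 hL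
    _ ≤ ((d : ℝ) + 1 + 2) * (2 + 2 * y ^ 2) := by gcongr
    _ = 2 * ((d : ℝ) + 1 + 2) +
        4 * Real.exp (4 * L / N) * (1 + 2 * ((d : ℝ) + 1 + 2) / N) * L := by linarith
    _ ≤ 8 * max L d + 4 * Real.exp (4 * r) * (7 + 2 * r) * max L d := by
      have := le_max_left L (d : ℝ)
      gcongr
    _ = _ := by ring

theorem EDkhi_exp_neg_le_const_mul_max {N L r : ℝ} {d : ℕ} (hN : 1 ≤ N) (hL : 0 ≤ L)
    (hr : 1 ≤ r) (hLr : L ≤ r * N) (hdr : d ≤ r * N) :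
    EDkhi (d + 1) N (Real.exp (-L)) ≤
      2 * (8 + 4 * Real.exp (4 * r) * (7 + 2 * r)) * max L d := by
  have hM0 : 0 ≤ max L (d : ℝ) := hL.trans (le_max_left _ _)
  set B := 8 + 4 * Real.exp (4 * r) * (7 + 2 * r) with hB
  have hB0 : 0 ≤ B := by positivity
  rcases le_or_gt 1 (max L (d : ℝ)) with hM | hM
  · refine (EDkhi_exp_neg_le_mul_max hN hL (by linarith) hLr hdr hM).trans ?_
    gcongr
    linarith
  · obtain ⟨hL1, hd1⟩ := max_lt_iff.1 hM
    obtain rfl : d = 0 := Nat.lt_one_iff.1 (by exact_mod_cast hd1)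
    -- The general bound does not vanish with L, so it is applied at level L = 1 and then scaled
    -- down by convexity; r ≥ 1 makes L = 1 admissible.
    have h1 := EDkhi_exp_neg_le_mul_max (d := 0) (L := 1) hN zero_le_one (by linarith)
      (by nlinarith) hdr (le_max_left _ _)
    have h2 := EDkhi_exp_neg_le_mul (D := ((0 : ℕ) : ℝ) + 1) (N := N) (by norm_num) (by linarith)
      hL hL1.le
    rw [← hB, Nat.cast_zero, max_eq_left zero_le_one, mul_one] at h1
    rw [Nat.cast_zero] at h2 ⊢
    rw [max_eq_left hL]
    calc _ ≤ 2 * L * _ := h2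
      _ ≤ 2 * L * B := by gcongr
      _ = _ := by ring

/-! ### The penalty bounds -/

theorem modelDim_add_modelCodim {n : ℕ} {ι : Type*}
    (S : ι → Submodule ℝ (EuclideanSpace ℝ (Fin n))) (m : ι) :
    modelDim S m + modelCodim S m = n := by
  have h := (S m).finrank_le
  rw [finrank_euclideanSpace_fin] at h
  exact Nat.add_sub_cancel' h

theorem penKL_le_mul_of_EDkhi_le {n : ℕ} {ι : Type*} {K x : ℝ}
    (S : ι → Submodule ℝ (EuclideanSpace ℝ (Fin n))) (L : ι → ℝ) (m : ι) (hK : 0 ≤ K)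
    (hN : 1 ≤ modelCodim S m)
    (h : EDkhi ((modelDim S m : ℝ) + 1) ((modelCodim S m : ℝ) - 1) (Real.exp (-L m)) ≤ x) :
    penKL K S L m ≤ K * ((modelCodim S m : ℝ) / ((modelCodim S m : ℝ) - 1)) * x := by
  have : (1 : ℝ) ≤ modelCodim S m := by exact_mod_cast hN
  exact mul_le_mul_of_nonneg_left h
    (mul_nonneg hK (div_nonneg (by linarith) (by linarith)))

theorem proposition4 (K : ℝ) (hK : 1 < K) :
    (∀ (n : ℕ) (ι : Type*) (S : ι → Submodule ℝ (EuclideanSpace ℝ (Fin n))) (L : ι → ℝ),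
      (∀ m, 0 ≤ L m) → ∀ m : ι,
        (7 ≤ modelCodim S m → 1 ≤ modelDim S m →
          ∀ D N Δ : ℝ, D = (modelDim S m : ℝ) + 1 → N = (modelCodim S m : ℝ) - 1 →
            Δ = (L m + Real.log 5 + 1 / N) / (1 - 5 / N) →
            penKL K S L m ≤
              K * (N + 1) / N *
                (1 + Real.exp (2 * Δ / (N + 2)) *
                  Real.sqrt ((1 + 2 * D / (N + 2)) * (2 * Δ / D))) ^ 2 * D) ∧
        (4 ≤ modelCodim S m → modelDim S m = 0 →
          ∀ N : ℝ, N = (modelCodim S m : ℝ) - 1 →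
            penKL K S L m ≤
              3 * K * (N + 1) / N *
                (1 + Real.exp (2 * L m / N) *
                  Real.sqrt ((1 + 6 / N) * (2 * L m / 3))) ^ 2)) ∧
    (∀ κ : ℝ, κ < 1 → ∃ C : ℝ, 0 < C ∧
      ∀ (n : ℕ) (ι : Type*) (S : ι → Submodule ℝ (EuclideanSpace ℝ (Fin n))) (L : ι → ℝ),
        (∀ m, 0 ≤ L m) → ∀ m : ι, 2 ≤ modelCodim S m →
          max (L m) (modelDim S m : ℝ) ≤ κ * n →
            penKL K S L m ≤ C * max (L m) (modelDim S m : ℝ)) := by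
  have hK0 : 0 < K := by linarith
  refine ⟨fun n ι S L hL m => ⟨fun hNm hDm D N Δ hD hN hΔ => ?_, fun hNm hDm N hN => ?_⟩,
    fun κ hκ => ?_⟩
  · have hNm' : (7 : ℝ) ≤ modelCodim S m := by exact_mod_cast hNm
    have hDm' : (1 : ℝ) ≤ modelDim S m := by exact_mod_cast hDm
    have h := EDkhi_exp_neg_le_of_two_le (by linarith : 2 ≤ D) (by linarith : 6 ≤ N) (hL m) hΔ
    rw [hD, hN] at h
    refine (penKL_le_mul_of_EDkhi_le S L m hK0.le (by omega) h).trans_eq ?_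
    rw [hD, hN, sub_add_cancel]
    ring
  · have hNm' : (4 : ℝ) ≤ modelCodim S m := by exact_mod_cast hNm
    have h := EDkhi_exp_neg_le (D := (modelDim S m : ℝ) + 1) (N := (modelCodim S m : ℝ) - 1)
      (by positivity) (by linarith) (hL m)
    refine (penKL_le_mul_of_EDkhi_le S L m hK0.le (by omega) h).trans_eq ?_
    rw [hN, sub_add_cancel, hDm, show ((0 : ℕ) : ℝ) + 1 + 2 = 3 by norm_num,
      show (2 : ℝ) * 3 = 6 by norm_num]
    ring
  · rcases lt_or_ge κ 0 with hκ0 | hκ0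
    -- For κ < 0 no model qualifies: n > 0, and the maximum is nonnegative.
    · refine ⟨1, one_pos, fun n ι S L hL m hNm hmax => ?_⟩
      have hn := modelDim_add_modelCodim S m
      have hn0 : (0 : ℝ) < n := by exact_mod_cast (by omega : 0 < n)
      exact absurd ((hL m).trans ((le_max_left _ _).trans hmax))
        (not_le.2 (mul_neg_of_neg_of_pos hκ0 hn0))
    have hκ1 : 0 < 1 - κ := by linarith
    -- D_m ≤ κn gives n ≤ N_m/(1 - κ), and N_m ≤ 2(N_m - 1); the added 1 ensures r ≥ 1.
    set r := 2 * κ / (1 - κ) + 1 with hr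
    have hr1 : 1 ≤ r := le_add_of_nonneg_left (by positivity)
    set B := 2 * (8 + 4 * Real.exp (4 * r) * (7 + 2 * r)) with hB
    have hB0 : 0 < B := by positivity
    refine ⟨K * 2 * B, by positivity, fun n ι S L hL m hNm hmax => ?_⟩
    have hn : (modelDim S m : ℝ) + modelCodim S m = n := by
      exact_mod_cast modelDim_add_modelCodim S m
    have hNm' : (2 : ℝ) ≤ modelCodim S m := by exact_mod_cast hNm
    obtain ⟨hLn, hdn⟩ := max_le_iff.1 hmax
    have hκn : κ * n ≤ r * ((modelCodim S m : ℝ) - 1) := by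
      have h1 : κ * n ≤ κ / (1 - κ) * modelCodim S m := by
        rw [div_mul_eq_mul_div, le_div_iff₀ hκ1, mul_assoc]
        exact mul_le_mul_of_nonneg_left (by linarith) hκ0
      have h2 : κ / (1 - κ) * modelCodim S m ≤
          κ / (1 - κ) * (2 * ((modelCodim S m : ℝ) - 1)) :=
        mul_le_mul_of_nonneg_left (by linarith) (by positivity)
      have h3 : r * ((modelCodim S m : ℝ) - 1) =
          κ / (1 - κ) * (2 * ((modelCodim S m : ℝ) - 1)) + ((modelCodim S m : ℝ) - 1) := by
        rw [hr]
        ring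
      linarith
    have h := EDkhi_exp_neg_le_const_mul_max (d := modelDim S m)
      (by linarith : 1 ≤ (modelCodim S m : ℝ) - 1) (hL m) hr1 (hLn.trans hκn) (hdn.trans hκn)
    refine (penKL_le_mul_of_EDkhi_le S L m hK0.le (by omega) h).trans ?_
    rw [mul_assoc (K * 2)]
    have hM0 : 0 ≤ max (L m) (modelDim S m : ℝ) := (hL m).trans (le_max_left _ _)
    refine mul_le_mul_of_nonneg_right (mul_le_mul_of_nonneg_left ?_ hK0.le) (by positivity)
    -- The factor N_m/(N_m - 1) is at most 2 since N_m ≥ 2.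
    rw [div_le_iff₀ (by linarith)]
    linarith
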